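/- Fix a natural number $m$. Formulas are built from countably many propositional letters by the Boolean operations, a unary operation $\mathbf N$ (next) and a binary operation $\mathbf S$ (since). A model consists of the set $\mathbb N$ of states together with a valuation $V$ assigning to each letter $p$ a set $V(p)\subseteq\mathbb N$. Truth at a state $a$ is defined as usual for letters and Boolean operations, and by $$a\Vdash \mathbf N\varphi \iff a+1\Vdash\varphi ,$$ $$a\Vdash \varphi\,\mathbf S\,\psi \iff \exists b\,\bigl[\,a\le b\le a+m,\ \ b\Vdash\psi,\ \text{ and } c\Vdash\varphi \text{ for all } c \text{ with } a\le c<b\,\bigr].$$ The logic $LTL_{Past,m}$ (non-transitive past linear temporal logic with uniform intransitivity bound $m$) is the set of all formulas that are true at every state of every such model. An inference rule $\varphi_1,\dots,\varphi_l/\psi$, where $\varphi_1,\dots,\varphi_l,\psi$ are formulas in letters $x_1,\dots,x_n$, is admissible in $LTL_{Past,m}$ if for all formulas $\alpha_1,\dots,\alpha_n$: whenever $\varphi_i(\alpha_1,\dots,\alpha_n)\in LTL_{Past,m}$ for all $i\le l$, then also $\psi(\alpha_1,\dots,\alpha_n)\in LTL_{Past,m}$. **Theorem.** For every natural number $m$,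 the logic $LTL_{Past,m}$ is decidable with respect to admissible inference rules: there is an algorithm that decides, for any given inference rule, whether it is admissible in $LTL_{Past,m}$. -/

import Mathlib

namespace LTLPast

/-- Formulas of the temporal language: propositional letters `var 0, var 1, …`, the Boolean
operations (negation and conjunction, in terms of which the others are defined), the unary
operation "next" and the binary operation "since" (`since φ ψ` is `φ S ψ`). -/
inductive Formula : Type
  | var (n : ℕ) : Formula
  | neg (φ : Formula) : Formula
  | conj (φ ψ : Formula) : Formula
  | next (φ : Formula) : Formula
  | since (φ ψ : Formula) : Formula

namespace Formula

/-- Gödel numbering of formulas. -/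
def toNat : Formula → ℕ
  | var n => 5 * n
  | neg φ => 5 * toNat φ + 1
  | next φ => 5 * toNat φ + 2
  | conj φ ψ => 5 * Nat.pair (toNat φ) (toNat ψ) + 3
  | since φ ψ => 5 * Nat.pair (toNat φ) (toNat ψ) + 4

/-- The formula with a given Gödel number. -/
def ofNat (n : ℕ) : Formula :=
  if n % 5 = 0 then var (n / 5)
  else if h1 : n % 5 = 1 then neg (ofNat (n / 5))
  else if h2 : n % 5 = 2 then next (ofNat (n / 5))
  else if h3 : n % 5 = 3 then
    conj (ofNat (Nat.unpair (n / 5)).1) (ofNat (Nat.unpair (n / 5)).2)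
  else if h4 : n % 5 = 4 then
    since (ofNat (Nat.unpair (n / 5)).1) (ofNat (Nat.unpair (n / 5)).2)
  else var 0
termination_by n
decreasing_by
  all_goals
    have hl := Nat.unpair_left_le (n / 5)
    have hr := Nat.unpair_right_le (n / 5)
    omega

theorem ofNat_toNat (φ : Formula) : ofNat (toNat φ) = φ := by
  induction φ with
  | var n => rw [toNat, ofNat]; simp
  | neg φ ih =>
    rw [toNat, ofNat, show (5 * toNat φ + 1) % 5 = 1 by omega,
      show (5 * toNat φ + 1) / 5 = toNat φ by omega]
    simp [ih]
  | next φ ih =>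
    rw [toNat, ofNat, show (5 * toNat φ + 2) % 5 = 2 by omega,
      show (5 * toNat φ + 2) / 5 = toNat φ by omega]
    simp [ih]
  | conj φ ψ ih1 ih2 =>
    rw [toNat, ofNat, show (5 * Nat.pair (toNat φ) (toNat ψ) + 3) % 5 = 3 by omega,
      show (5 * Nat.pair (toNat φ) (toNat ψ) + 3) / 5 = Nat.pair (toNat φ) (toNat ψ) by omega]
    simp [ih1, ih2]
  | since φ ψ ih1 ih2 =>
    rw [toNat, ofNat, show (5 * Nat.pair (toNat φ) (toNat ψ) + 4) % 5 = 4 by omega,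
      show (5 * Nat.pair (toNat φ) (toNat ψ) + 4) / 5 = Nat.pair (toNat φ) (toNat ψ) by omega]
    simp [ih1, ih2]

theorem toNat_ofNat (n : ℕ) : toNat (ofNat n) = n := by
  induction n using Nat.strong_induction_on with
  | _ n ih =>
    have hl := Nat.unpair_left_le (n / 5)
    have hr := Nat.unpair_right_le (n / 5)
    rw [ofNat]
    split_ifs with h0 h1 h2 h3 h4
    · simp only [toNat]; omega
    · simp only [toNat]; rw [ih _ (by omega)]; omega
    · simp only [toNat]; rw [ih _ (by omega)]; omega
    · simp only [toNat]; rw [ih _ (by omega), ih _ (by omega), Nat.pair_unpair]; omega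
    · simp only [toNat]; rw [ih _ (by omega), ih _ (by omega), Nat.pair_unpair]; omega
    · omega

/-- The Gödel numbering is a bijection between formulas and natural numbers. -/
def equivNat : Formula ≃ ℕ where
  toFun := toNat
  invFun := ofNat
  left_inv := ofNat_toNat
  right_inv := toNat_ofNat

/-- Algorithms on formulas operate on Gödel numbers. -/
instance : Primcodable Formula := Primcodable.ofEquiv ℕ equivNat

/-- Simultaneous substitution of formulas for the letters. -/
def subst (σ : ℕ → Formula) : Formula → Formula
  | var n => σ n
  | neg φ => neg (subst σ φ)
  | conj φ ψ => conj (subst σ φ) (subst σ ψ)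
  | next φ => next (subst σ φ)
  | since φ ψ => since (subst σ φ) (subst σ ψ)

end Formula

/-- The relation `Next` of the frame: `b` is the number following `a`
(time is directed to the past, so larger numbers are earlier moments). -/
def Next (a b : ℕ) : Prop := b = a + 1

/-- The relation `R i` of the frame with measure of intransitivity `m`: the standard linear order
`≥` on the interval `[i, i + m]`. -/
def R (m i : ℕ) (b c : ℕ) : Prop :=
  b ∈ Set.Icc i (i + m) ∧ c ∈ Set.Icc i (i + m) ∧ b ≥ c

/-- `Sat m V a φ`: the formula `φ` is true at the state `a` of the model given by the valuation `V`
(`V p` is the set of states where the letter `p` is true) on the frame with measure of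
intransitivity `m`. -/
def Sat (m : ℕ) (V : ℕ → Set ℕ) : ℕ → Formula → Prop
  | a, .var p => a ∈ V p
  | a, .neg φ => ¬ Sat m V a φ
  | a, .conj φ ψ => Sat m V a φ ∧ Sat m V a ψ
  | a, .next φ => ∀ b, Next a b → Sat m V b φ
  | a, .since φ ψ =>
      ∃ b, R m a b a ∧ Sat m V b ψ ∧ ∀ c, a ≤ c ∧ c < b → Sat m V c φ

/-- The logic `LTL_{Past,m}`: the set of all formulas true at every state of every model with
measure of intransitivity `m`. -/
def Logic (m : ℕ) : Set Formula :=
  {φ | ∀ (V : ℕ → Set ℕ) (a : ℕ), Sat m V a φ}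

/-- An inference rule: finitely many premisses and a conclusion. -/
structure Rule : Type where
  premisses : List Formula
  conclusion : Formula

/-- A rule is the same thing as a pair (list of premisses, conclusion). -/
def Rule.equivProd : Rule ≃ List Formula × Formula where
  toFun r := (r.premisses, r.conclusion)
  invFun p := ⟨p.1, p.2⟩
  left_inv _ := rfl
  right_inv _ := rfl

/-- Algorithms on rules operate on codes of pairs (list of premisses, conclusion). -/
instance : Primcodable Rule := Primcodable.ofEquiv (List Formula × Formula) Rule.equivProd

/-- A rule is admissible in a logic `L` if every substitution of formulas for the letters that turns
all premisses into theorems of `L` also turns the conclusion into a theorem of `L`. -/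
def Rule.Admissible (L : Set Formula) (r : Rule) : Prop :=
  ∀ σ : ℕ → Formula, (∀ φ ∈ r.premisses, φ.subst σ ∈ L) → r.conclusion.subst σ ∈ L

end LTLPast

/-! Truth is local: a formula sees a window of bounded length, and only states after the one of
evaluation. Fix a rule and let words be windows long enough for all its formulas. Words form a
finite graph: an edge leaves a word whose first state satisfies the premisses and leads to a word
overlapping it after a shift by one. The rule fails to be admissible iff some word `z` with a loop
lies on a closed walk through a word `w` refuting the conclusion (`Rule.admissible_iff`). If a
substitution refutes the rule, cut its countermodel down to a finite window, with all letters false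
outside. The substituted formulas take the same constant values far to the left and far to the
right, which gives `z`; reading the words along the model gives the closed walk
(`exists_valuation_eventually_const`). Conversely, a closed walk of length `L` is turned into
formulas in one letter. An isolated occurrence of that letter acts as a marker: the distance to it
says which vertex of the walk to display, and where no marker is near, `z` is displayed. The loop at
`z` makes this a walk under every valuation, so the premisses become theorems, and one valuation
displays `w` (`exists_subst_of_closed_walk`). The graph condition uses only bounded quantifiers over
coded words, truth tables and sets of words, so it is primitive recursive. -/

namespace LTLPast

open Relation

/-! ### Locality of truth, substitution and definability -/

section Semantics

variable {m : ℕ} {V V' : ℕ → Set ℕ}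

theorem sat_next {a : ℕ} {φ : Formula} : Sat m V a φ.next ↔ Sat m V (a + 1) φ := by
  simp [Sat, Next]

theorem sat_since {a : ℕ} {φ ψ : Formula} :
    Sat m V a (φ.since ψ) ↔
      ∃ b, b < m + 1 ∧ Sat m V (a + b) ψ ∧ ∀ c, c < b → Sat m V (a + c) φ := by
  simp only [Sat, R, Set.mem_Icc]
  constructor
  · rintro ⟨b, ⟨⟨h1, h2⟩, -, -⟩, hψ, hφ⟩
    refine ⟨b - a, by omega, by rwa [Nat.add_sub_cancel' h1], fun c hc => hφ _ (by omega)⟩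
  · rintro ⟨b, hb, hψ, hφ⟩
    refine ⟨a + b, by omega, hψ, fun c hc => ?_⟩
    have := hφ (c - a) (by omega)
    rwa [Nat.add_sub_cancel' hc.1] at this

/-- The truth of `φ` at `a` depends only on the letters up to `φ.toNat` and on the states of
`[a, a + (m + 1) * φ.toNat]`. -/
theorem sat_congr (φ : Formula) {a a' : ℕ}
    (h : ∀ p ≤ φ.toNat, ∀ i ≤ (m + 1) * φ.toNat, (a + i ∈ V p ↔ a' + i ∈ V' p)) :
    Sat m V a φ ↔ Sat m V' a' φ := by
  induction φ generalizing a a' with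
  | var n => exact h n (by simp only [Formula.toNat]; omega) 0 (Nat.zero_le _)
  | neg φ ih =>
    simp only [Formula.toNat] at h
    exact not_congr (ih fun p hp i hi => h p (by omega) i (by nlinarith))
  | conj φ ψ ih1 ih2 =>
    have hl := Nat.left_le_pair φ.toNat ψ.toNat
    have hr := Nat.right_le_pair φ.toNat ψ.toNat
    simp only [Formula.toNat] at h
    exact and_congr (ih1 fun p hp i hi => h p (by omega) i (by nlinarith))
      (ih2 fun p hp i hi => h p (by omega) i (by nlinarith))
  | next φ ih =>
    simp only [Formula.toNat] at h
    rw [sat_next, sat_next]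
    refine ih fun p hp i hi => ?_
    rw [add_assoc, add_assoc]
    exact h p (by omega) (1 + i) (by nlinarith)
  | since φ ψ ih1 ih2 =>
    have hl := Nat.left_le_pair φ.toNat ψ.toNat
    have hr := Nat.right_le_pair φ.toNat ψ.toNat
    simp only [Formula.toNat] at h
    rw [sat_since, sat_since]
    refine exists_congr fun b => and_congr_right fun hb => and_congr ?_ ?_
    · refine ih2 fun p hp i hi => ?_
      rw [add_assoc, add_assoc]
      exact h p (by omega) (b + i) (by nlinarith)
    · refine forall_congr' fun c => imp_congr_right fun hc => ih1 fun p hp i hi => ?_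
      rw [add_assoc, add_assoc]
      exact h p (by omega) (c + i) (by nlinarith)

/-- A substitution acts as a change of valuation, so substitutions can be studied through the
valuations they define. -/
theorem sat_subst (σ : ℕ → Formula) (φ : Formula) (a : ℕ) :
    Sat m V a (φ.subst σ) ↔ Sat m (fun p => {x | Sat m V x (σ p)}) a φ := by
  induction φ generalizing a with
  | var n => rfl
  | neg φ ih => exact not_congr (ih a)
  | conj φ ψ ih1 ih2 => exact and_congr (ih1 a) (ih2 a)
  | next φ ih => simp only [Formula.subst, sat_next, ih]
  | since φ ψ ih1 ih2 => simp only [Formula.subst, sat_since, ih1, ih2]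

/-- Every property of a bounded window of the letter `0` is expressed by a formula. -/
theorem exists_formula_of_window (m k : ℕ) (Q : (ℕ → Prop) → Prop)
    (hQ : ∀ B B' : ℕ → Prop, (∀ i < k, B i ↔ B' i) → (Q B ↔ Q B')) :
    ∃ α : Formula, ∀ (V : ℕ → Set ℕ) (a : ℕ), Sat m V a α ↔ Q fun i => a + i ∈ V 0 := by
  induction k generalizing Q with
  | zero =>
    by_cases h : Q fun _ => True
    · refine ⟨.neg (.conj (.var 0) (.neg (.var 0))), fun V a => ?_⟩
      simp only [Sat, and_not_self, not_false_eq_true, true_iff]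
      exact (hQ _ _ (by simp)).1 h
    · refine ⟨.conj (.var 0) (.neg (.var 0)), fun V a => ?_⟩
      simp only [Sat, and_not_self, false_iff]
      exact fun h' => h ((hQ _ _ (by simp)).1 h')
  | succ k ih =>
    let cons (b : Prop) (B : ℕ → Prop) : ℕ → Prop := fun i => Nat.casesOn i b B
    have key (b : Prop) : ∃ α : Formula, ∀ (V : ℕ → Set ℕ) (a : ℕ),
        Sat m V a α ↔ Q (cons b fun i => a + i ∈ V 0) := by
      refine ih (fun B => Q (cons b B)) fun B B' h => hQ _ _ fun i hi => ?_
      cases i with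
      | zero => exact Iff.rfl
      | succ i => exact h i (by omega)
    obtain ⟨α, hα⟩ := key True
    obtain ⟨β, hβ⟩ := key False
    -- Case split on the letter at the current state; `next` hands the other `k` places to the
    -- induction hypothesis.
    refine ⟨.neg (.conj (.neg (.conj (.var 0) (.next α)))
      (.neg (.conj (.neg (.var 0)) (.next β)))), fun V a => ?_⟩
    have hcons (b : Prop) (hb : b ↔ a ∈ V 0) :
        Q (cons b fun i => a + 1 + i ∈ V 0) ↔ Q fun i => a + i ∈ V 0 := by
      refine hQ _ _ fun i _ => ?_
      cases i with
      | zero => exact hb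
      | succ i =>
        change a + 1 + i ∈ V 0 ↔ a + (i + 1) ∈ V 0
        rw [show a + 1 + i = a + (i + 1) by omega]
    have e : Sat m V a (.neg (.conj (.neg (.conj (.var 0) (.next α)))
        (.neg (.conj (.neg (.var 0)) (.next β))))) ↔
        (a ∈ V 0 ∧ Sat m V (a + 1) α) ∨ (a ∉ V 0 ∧ Sat m V (a + 1) β) := by
      rw [← sat_next, ← sat_next]
      simp only [Sat]
      tauto
    rw [e, hα, hβ]
    by_cases h : a ∈ V 0
    · simp only [h, true_and, not_true_eq_false, false_and, or_false]
      exact hcons _ (by simp [h])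
    · simp only [h, false_and, not_false_eq_true, true_and, false_or]
      exact hcons _ (by simp [h])

end Semantics

/-! ### Markers in a sequence -/

section Marker

/-- The sequence `B` has a marker at `r`: it holds at `r` and at none of the next `L - 1` places. -/
def Marker (L : ℕ) (B : ℕ → Prop) (r : ℕ) : Prop :=
  B r ∧ ∀ j, r < j → j < r + L → ¬ B j

/-- `r` is the distance to the marker among the first `L` places, or `0` if there is none. -/
def MarkerDist (L : ℕ) (B : ℕ → Prop) (r : ℕ) : Prop :=
  (r < L ∧ Marker L B r) ∨ (r = 0 ∧ ∀ s < L, ¬ Marker L B s)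

/-- Of two markers, the later would fall in the stretch that the earlier requires to be empty. -/
theorem Marker.unique {L : ℕ} {B : ℕ → Prop} {r s : ℕ} (hr : Marker L B r) (hs : Marker L B s)
    (hrL : r < L) (hsL : s < L) : r = s := by
  rcases lt_trichotomy r s with h | h | h
  · exact absurd hs.1 (hr.2 s h (by omega))
  · exact h
  · exact absurd hr.1 (hs.2 r h (by omega))

theorem MarkerDist.unique {L : ℕ} {B : ℕ → Prop} {r s : ℕ} (hr : MarkerDist L B r)
    (hs : MarkerDist L B s) : r = s := by
  rcases hr with ⟨h1, h2⟩ | ⟨h1, h2⟩ <;> rcases hs with ⟨h3, h4⟩ | ⟨h3, h4⟩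
  · exact h2.unique h4 h1 h3
  · exact absurd h2 (h4 _ h1)
  · exact absurd h4 (h2 _ h3)
  · omega

theorem exists_markerDist (L : ℕ) (B : ℕ → Prop) : ∃ r, MarkerDist L B r := by
  by_cases h : ∃ r < L, Marker L B r
  · obtain ⟨r, h⟩ := h
    exact ⟨r, .inl h⟩
  · push Not at h
    exact ⟨0, .inr ⟨rfl, h⟩⟩

theorem MarkerDist.lt {L : ℕ} {B : ℕ → Prop} {r : ℕ} (hL : 0 < L) (h : MarkerDist L B r) :
    r < L := by
  rcases h with h | h <;> omega

theorem marker_succ {L : ℕ} {B : ℕ → Prop} {s : ℕ} :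
    Marker L (fun i => B (i + 1)) s ↔ Marker L B (s + 1) := by
  refine and_congr Iff.rfl ⟨fun h j h1 h2 => ?_, fun h j h1 h2 => h _ (by omega) (by omega)⟩
  have : ¬ B (j - 1 + 1) := h (j - 1) (by omega) (by omega)
  rwa [show j - 1 + 1 = j by omega] at this

/-- Shifting by one brings a marker one place closer; a new marker can only enter at the far end `L
- 1`, and only when the old distance is `0`. -/
theorem MarkerDist.step {L : ℕ} {B : ℕ → Prop} {r s : ℕ} (hr : MarkerDist L B r)
    (hs : MarkerDist L (fun i => B (i + 1)) s) :
    r = s + 1 ∨ (r = 0 ∧ (s = 0 ∨ s + 1 = L)) := by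
  rcases hs with ⟨h1, h2⟩ | ⟨h1, h2⟩
  · rw [marker_succ] at h2
    by_cases h3 : s + 1 < L
    · exact .inl (hr.unique (.inl ⟨h3, h2⟩))
    · refine .inr ⟨?_, .inr (by omega)⟩
      rcases hr with ⟨h4, h5⟩ | ⟨h4, -⟩
      · by_contra h
        exact h5.2 (s + 1) (by omega) (by omega) h2.1
      · exact h4
  · subst h1
    refine .inr ⟨?_, .inl rfl⟩
    rcases hr with ⟨h4, h5⟩ | ⟨h4, -⟩
    · by_contra h
      refine h2 (r - 1) (by omega) ?_
      rwa [marker_succ, show r - 1 + 1 = r by omega]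
    · exact h4

/-- A marker at `r < L` inspects places below `r + L < 2 * L`, so the distance is definable by a
formula. -/
theorem MarkerDist.congr {L : ℕ} {B B' : ℕ → Prop} (h : ∀ i < 2 * L, B i ↔ B' i) (r : ℕ) :
    MarkerDist L B r ↔ MarkerDist L B' r := by
  have key : ∀ s < L, (Marker L B s ↔ Marker L B' s) := fun s hs =>
    and_congr (h s (by omega)) <| forall_congr' fun j => imp_congr_right fun _ =>
      imp_congr_right fun hj => not_congr (h j (by omega))
  exact or_congr (and_congr_right fun hr => key r hr)
    (and_congr_right fun _ => forall_congr' fun s => imp_congr_right fun hs =>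
      not_congr (key s hs))

end Marker

/-! ### From closed walks to substitutions and back -/

theorem exists_walk_of_reflTransGen {ι : Type*} {E : ι → ι → Prop} {a b : ι}
    (h : ReflTransGen E a b) :
    ∃ (L : ℕ) (v : ℕ → ι), v 0 = a ∧ v L = b ∧ ∀ i < L, E (v i) (v (i + 1)) := by
  induction h using ReflTransGen.head_induction_on with
  | refl => exact ⟨0, fun _ => b, rfl, rfl, by simp⟩
  | @head a c hac _ ih =>
    obtain ⟨L, v, h0, hL, hv⟩ := ih
    refine ⟨L + 1, fun i => Nat.casesOn i a v, rfl, hL, fun i hi => ?_⟩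
    cases i with
    | zero => simpa [h0] using hac
    | succ i => exact hv i (by omega)

/-- The loop at `z` is traversed once at the start. This forces `0 < t` even if `w = z`, so that a
marker at place `L - t` lies among the first `L` places. -/
theorem exists_closed_walk {ι : Type*} {E : ι → ι → Prop} {z w : ι}
    (hz : E z z) (hzw : ReflTransGen E z w) (hwz : ReflTransGen E w z) :
    ∃ (L t : ℕ) (v : ℕ → ι), v 0 = z ∧ v L = z ∧ v t = w ∧ 0 < t ∧ t ≤ L ∧
      ∀ i < L, E (v i) (v (i + 1)) := by
  obtain ⟨L, u, hu0, huL, hu⟩ := exists_walk_of_reflTransGen hzw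
  obtain ⟨L', u', hu0', huL', hu'⟩ := exists_walk_of_reflTransGen hwz
  refine ⟨L + 1 + L', L + 1,
    fun i => if i ≤ L + 1 then Nat.casesOn i z u else u' (i - (L + 1)), rfl, ?_, ?_,
    by omega, by omega, fun i hi => ?_⟩
  · rcases Nat.eq_zero_or_pos L' with rfl | h
    · simp [huL, ← hu0', huL']
    · simp [huL', h.ne']
  · simp [huL]
  · rcases lt_trichotomy i (L + 1) with h | rfl | h
    · simp only [show i ≤ L + 1 by omega, show i + 1 ≤ L + 1 by omega, if_true]
      cases i with
      | zero => simpa [hu0] using hz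
      | succ i => exact hu i (by omega)
    · have := hu' 0 (by omega)
      rw [hu0', ← huL] at this
      beta_reduce
      rw [if_pos le_rfl, if_neg (by omega), Nat.add_sub_cancel_left]
      exact this
    · simp only [show ¬ i ≤ L + 1 by omega, show ¬ i + 1 ≤ L + 1 by omega, if_false]
      have := hu' (i - (L + 1)) (by omega)
      rwa [show i - (L + 1) + 1 = i + 1 - (L + 1) by omega] at this

/-- If `z` has a loop and lies on a closed walk through `w` in a labelled graph, then some
substitution produces only infinite walks of the graph, and one of them starts at `w`. -/
theorem exists_subst_of_closed_walk (m : ℕ) {ι : Type*} {E : ι → ι → Prop} (lab : ι → ℕ → Prop)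
    {z w : ι} (hz : E z z) (hzw : ReflTransGen E z w) (hwz : ReflTransGen E w z) :
    ∃ σ : ℕ → Formula,
      (∀ V, ∃ s : ℕ → ι, (∀ x, E (s x) (s (x + 1))) ∧
        ∀ x p, Sat m V x (σ p) ↔ lab (s x) p) ∧
      ∃ V, ∃ s : ℕ → ι, (∀ x, E (s x) (s (x + 1))) ∧
        (∀ x p, Sat m V x (σ p) ↔ lab (s x) p) ∧ s 0 = w := by
  obtain ⟨L, t, v, hv0, hvL, hvt, ht0, htL, hv⟩ := exists_closed_walk hz hzw hwz
  have hdef (p : ℕ) := exists_formula_of_window m (2 * L)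
    (fun B => ∃ r, MarkerDist L B r ∧ lab (v (L - r)) p)
    (fun B B' h => exists_congr fun r => and_congr_left fun _ => MarkerDist.congr h r)
  choose σ hσ using hdef
  have key (V : ℕ → Set ℕ) : ∃ s : ℕ → ι, (∀ x, E (s x) (s (x + 1))) ∧
      (∀ x p, Sat m V x (σ p) ↔ lab (s x) p) ∧
      ∀ r, MarkerDist L (fun i => 0 + i ∈ V 0) r → s 0 = v (L - r) := by
    choose d hd using fun x => exists_markerDist L fun i => x + i ∈ V 0
    -- Distance `r` displays vertex `L - r`. Distance `0`, the default value included, gives `v L =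
    -- z`, from which the walk either loops or restarts at `v 1`.
    refine ⟨fun x => v (L - d x), fun x => ?_, fun x p => ?_, fun r hr => ?_⟩
    · have h' : MarkerDist L (fun i => x + (i + 1) ∈ V 0) (d (x + 1)) := by
        have := hd (x + 1)
        simp only [add_assoc, add_comm 1] at this
        exact this
      have hlt := (hd x).lt (by omega)
      have hlt' := (hd (x + 1)).lt (by omega)
      rcases (hd x).step h' with h | ⟨h1, h2 | h2⟩
      · have := hv (L - d x) (by omega)
        rwa [show L - d x + 1 = L - d (x + 1) by omega] at this
      · beta_reduce
        rw [h1, h2, Nat.sub_zero, hvL]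
        exact hz
      · have := hv 0 (by omega)
        rw [hv0, ← hvL] at this
        beta_reduce
        rw [h1, Nat.sub_zero, show L - d (x + 1) = 0 + 1 by omega]
        exact this
    · rw [hσ]
      exact ⟨fun ⟨r, hr, h⟩ => by obtain rfl := hr.unique (hd x); exact h, fun h => ⟨_, hd x, h⟩⟩
    · rw [hr.unique (hd 0)]
  refine ⟨σ, fun V => ?_, fun _ => {L - t}, ?_⟩
  · obtain ⟨s, h1, h2, -⟩ := key V
    exact ⟨s, h1, h2⟩
  · obtain ⟨s, h1, h2, h3⟩ := key fun _ => {L - t}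
    refine ⟨s, h1, h2, ?_⟩
    rw [h3 (L - t) (.inl ⟨by omega, by simp [Marker]; omega⟩), ← hvt]
    congr 1
    omega

/-- A substitution instance refuting a conclusion can be embedded between two constant stretches. -/
theorem exists_valuation_eventually_const {m : ℕ} (σ : ℕ → Formula) (n D : ℕ) {ψ : Formula}
    (hψ : ψ.subst σ ∉ Logic m) :
    ∃ (V : ℕ → Set ℕ) (K X : ℕ), K ≤ X ∧ ¬ Sat m V K (ψ.subst σ) ∧
      ∀ p < n, ∀ x, x ≤ D ∨ X ≤ x → (Sat m V x (σ p) ↔ Sat m V 0 (σ p)) := by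
  simp only [Logic, Set.mem_ofPred_eq, not_forall] at hψ
  obtain ⟨V, a, hV⟩ := hψ
  -- `d` bounds the windows of the refuted formula and of all `σ p` with `p < n`.
  set d := (m + 1) * (∑ p ∈ Finset.range n, (σ p).toNat + (ψ.subst σ).toNat) with hd
  have hdψ : (m + 1) * (ψ.subst σ).toNat ≤ d := Nat.mul_le_mul_left _ (Nat.le_add_left _ _)
  have hdσ (p : ℕ) (hp : p < n) : (m + 1) * (σ p).toNat ≤ d := by
    refine Nat.mul_le_mul_left _ (le_trans ?_ (Nat.le_add_right _ _))
    exact Finset.single_le_sum (f := fun p => (σ p).toNat) (fun _ _ => Nat.zero_le _)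
      (Finset.mem_range.2 hp)
  set K := D + d + 1
  -- The window of `V` at `a` is moved to `K`, and everything else is made false. Windows starting
  -- at `x ≤ D` end before `K`.
  refine ⟨fun p => {x | K ≤ x ∧ x ≤ K + d ∧ a + (x - K) ∈ V p}, K, K + d + 1, by omega,
    fun h => hV ?_, fun p hp x hx => ?_⟩
  · refine (sat_congr _ fun p _ i hi => ?_).1 h
    have : i ≤ d := hi.trans hdψ
    simp [this]
  · refine sat_congr _ fun q _ i hi => ?_
    have : i ≤ d := hi.trans (hdσ p hp)
    simp only [Set.mem_ofPred_eq]
    constructor <;> rintro ⟨h1, h2, -⟩ <;> omega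

/-! ### Arithmetical coding of words and truth tables -/

/-- The binary digit of `u` at place `i` is `1`. -/
def Bit (u i : ℕ) : Prop := u / 2 ^ i % 2 = 1

theorem exists_bit_iff (k : ℕ) (f : ℕ → Prop) : ∃ u < 2 ^ k, ∀ i < k, (Bit u i ↔ f i) := by
  classical
  refine ⟨Nat.ofBits fun i : Fin k => decide (f i), Nat.ofBits_lt_two_pow _, fun i hi => ?_⟩
  have := Nat.testBit_ofBits_lt (fun i : Fin k => decide (f i)) i hi
  rw [Nat.testBit_eq_decide_div_mod_eq] at this
  simpa [Bit] using this

/-- The valuation coded by the word `u` of length `D + 1` over the alphabet of `n` letters, the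
last state being repeated. -/
def wordVal (n D u : ℕ) (p : ℕ) : Set ℕ := {a | Bit u (min a D * n + p)}

/-- `T` is a correct table of the truth values at the states `0, …, D` of the formulas with
Gödel numbers up to `k`, in the model coded by `u`. -/
def IsTruthTable (m n D u k T : ℕ) : Prop :=
  ∀ j, j < k + 1 → ∀ a, a < D + 1 → (Bit T (j * (D + 1) + a) ↔
    (j % 5 = 0 ∧ Bit u (min a D * n + j / 5)) ∨
    (j % 5 = 1 ∧ ¬ Bit T (j / 5 * (D + 1) + a)) ∨
    (j % 5 = 2 ∧ Bit T (j / 5 * (D + 1) + min (a + 1) D)) ∨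
    (j % 5 = 3 ∧ Bit T ((Nat.unpair (j / 5)).1 * (D + 1) + a) ∧
      Bit T ((Nat.unpair (j / 5)).2 * (D + 1) + a)) ∨
    (j % 5 = 4 ∧ ∃ b, b < m + 1 ∧ Bit T ((Nat.unpair (j / 5)).2 * (D + 1) + min (a + b) D) ∧
      ∀ c, c < b → Bit T ((Nat.unpair (j / 5)).1 * (D + 1) + min (a + c) D)))

/-- The formula with Gödel number `k` is true at the state `0` of the model coded by `u`. -/
def TrueAtZero (m n D u k : ℕ) : Prop :=
  ∃ T, T < 2 ^ ((k + 1) * (D + 1)) ∧ IsTruthTable m n D u k T ∧ Bit T (k * (D + 1))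

theorem sat_wordVal_min {m n D u : ℕ} (φ : Formula) (a : ℕ) :
    Sat m (wordVal n D u) (min a D) φ ↔ Sat m (wordVal n D u) a φ := by
  refine sat_congr φ fun p _ i _ => ?_
  simp only [wordVal, Set.mem_ofPred_eq]
  rw [show min (min a D + i) D = min (a + i) D by omega]

/-- The local conditions determine the table by induction on formulas. States beyond `D` see the
same constant future as `D`, hence the truncations by `min`. -/
theorem IsTruthTable.bit_iff {m n D u k T : ℕ} (h : IsTruthTable m n D u k T) (φ : Formula)
    (hφ : φ.toNat ≤ k) (a : ℕ) :
    Bit T (φ.toNat * (D + 1) + min a D) ↔ Sat m (wordVal n D u) a φ := by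
  rw [← sat_wordVal_min]
  obtain ⟨a', ha', ha''⟩ : ∃ a', a' = min a D ∧ a' < D + 1 := ⟨_, rfl, by omega⟩
  have hm : min a' D = a' := by omega
  rw [← ha']
  clear ha'
  induction φ generalizing a' with
  | var p =>
    simp only [Formula.toNat] at hφ ⊢
    rw [h _ (by omega) _ ha'']
    simp [Sat, wordVal]
  | neg φ ih =>
    simp only [Formula.toNat] at hφ ⊢
    rw [h _ (by omega) _ ha'']
    simp [Sat, Nat.mul_add_div, ih (by omega) a' ha'' hm]
  | next φ ih =>
    simp only [Formula.toNat] at hφ ⊢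
    rw [h _ (by omega) _ ha'', sat_next, ← sat_wordVal_min]
    simp [Nat.mul_add_div, ih (by omega) (min (a' + 1) D) (by omega) (by simp)]
  | conj φ ψ ih1 ih2 =>
    simp only [Formula.toNat] at hφ ⊢
    have hl := Nat.left_le_pair φ.toNat ψ.toNat
    have hr := Nat.right_le_pair φ.toNat ψ.toNat
    rw [h _ (by omega) _ ha'']
    simp [Sat, Nat.mul_add_div, ih1 (by omega) a' ha'' hm,
      ih2 (by omega) a' ha'' hm]
  | since φ ψ ih1 ih2 =>
    simp only [Formula.toNat] at hφ ⊢
    have hl := Nat.left_le_pair φ.toNat ψ.toNat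
    have hr := Nat.right_le_pair φ.toNat ψ.toNat
    have e1 (b : ℕ) := ih1 (by omega) (min (a' + b) D) (by omega) (by simp)
    have e2 (b : ℕ) := ih2 (by omega) (min (a' + b) D) (by omega) (by simp)
    simp only [sat_wordVal_min] at e1 e2
    rw [h _ (by omega) _ ha'', sat_since]
    simp [Nat.mul_add_div, e1, e2]

theorem exists_isTruthTable (m n D u k : ℕ) :
    ∃ T < 2 ^ ((k + 1) * (D + 1)), IsTruthTable m n D u k T := by
  obtain ⟨T, hT, h⟩ := exists_bit_iff ((k + 1) * (D + 1)) fun i =>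
    Sat m (wordVal n D u) (i % (D + 1)) (Formula.ofNat (i / (D + 1)))
  have key (φ : Formula) (hφ : φ.toNat < k + 1) (a : ℕ) (ha : a < D + 1) :
      Bit T (φ.toNat * (D + 1) + a) ↔ Sat m (wordVal n D u) a φ := by
    rw [h _ (by nlinarith)]
    rw [mul_comm, Nat.mul_add_mod, Nat.mul_add_div (by omega), Nat.mod_eq_of_lt ha,
      Nat.div_eq_of_lt ha, add_zero, Formula.ofNat_toNat]
  refine ⟨T, hT, fun j hj a ha => ?_⟩
  obtain ⟨φ, rfl⟩ : ∃ φ : Formula, φ.toNat = j := ⟨_, Formula.toNat_ofNat j⟩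
  rw [key φ hj a ha]
  cases φ with
  | var p => simp [Formula.toNat, Sat, wordVal]
  | neg φ =>
    simp only [Formula.toNat] at hj ⊢
    simp [Sat, Nat.mul_add_div, key φ (by omega) a ha]
  | next φ =>
    simp only [Formula.toNat] at hj ⊢
    rw [sat_next, ← sat_wordVal_min]
    simp [Nat.mul_add_div, key φ (by omega) (min (a + 1) D) (by omega)]
  | conj φ ψ =>
    simp only [Formula.toNat] at hj ⊢
    have hl := Nat.left_le_pair φ.toNat ψ.toNat
    have hr := Nat.right_le_pair φ.toNat ψ.toNat
    simp [Sat, Nat.mul_add_div, key φ (by omega) a ha, key ψ (by omega) a ha]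
  | since φ ψ =>
    simp only [Formula.toNat] at hj ⊢
    have hl := Nat.left_le_pair φ.toNat ψ.toNat
    have hr := Nat.right_le_pair φ.toNat ψ.toNat
    have e1 (b : ℕ) := key φ (by omega) (min (a + b) D) (by omega)
    have e2 (b : ℕ) := key ψ (by omega) (min (a + b) D) (by omega)
    simp only [sat_wordVal_min] at e1 e2
    rw [sat_since]
    simp [Nat.mul_add_div, e1, e2]

theorem trueAtZero_iff {m n D u : ℕ} (φ : Formula) :
    TrueAtZero m n D u φ.toNat ↔ Sat m (wordVal n D u) 0 φ := by
  constructor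
  · rintro ⟨T, -, h, hb⟩
    exact (h.bit_iff φ le_rfl 0).1 (by simpa using hb)
  · intro hs
    obtain ⟨T, hT, h⟩ := exists_isTruthTable m n D u φ.toNat
    exact ⟨T, hT, h, by simpa using (h.bit_iff φ le_rfl 0).2 hs⟩

/-! ### The graph of words of a rule -/

/-- The number of letters in the words considered for the rule `r`. -/
def Rule.letters (r : Rule) : ℕ := Encodable.encode r + 1

/-- The words considered for the rule `r` have length `r.span m + 1`. -/
def Rule.span (m : ℕ) (r : Rule) : ℕ := (m + 1) * Encodable.encode r

/-- The number of words considered for the rule `r`. -/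
def Rule.words (m : ℕ) (r : Rule) : ℕ := 2 ^ ((r.span m + 1) * r.letters)

/-- The word `u` satisfies the premisses of `r`, and it can be followed by the word `v`. -/
def Rule.Edge (m : ℕ) (r : Rule) (u v : ℕ) : Prop :=
  (∀ k ∈ r.premisses.map Formula.toNat, TrueAtZero m r.letters (r.span m) u k) ∧
  ∀ a, a < r.span m → ∀ p, p < r.letters →
    (Bit u ((a + 1) * r.letters + p) ↔ Bit v (a * r.letters + p))

/-- The word `v` belongs to every set of words which contains `u` and is closed under edges. -/
def Rule.Reach (m : ℕ) (r : Rule) (u v : ℕ) : Prop :=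
  ∀ C, C < 2 ^ r.words m → Bit C u →
    (∀ x, x < r.words m → ∀ y, y < r.words m → Bit C x → r.Edge m x y → Bit C y) → Bit C v

/-- There is a constant word with a loop which lies on a closed walk through a word refuting the
conclusion of `r`. -/
def Rule.Refutable (m : ℕ) (r : Rule) : Prop :=
  ∃ z, z < r.words m ∧ ∃ w, w < r.words m ∧ r.Edge m z z ∧
    ¬ TrueAtZero m r.letters (r.span m) w r.conclusion.toNat ∧ r.Reach m z w ∧ r.Reach m w z

/-- Edges between words of the length considered for `r`. -/
def Rule.WordEdge (m : ℕ) (r : Rule) (u v : ℕ) : Prop :=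
  r.Edge m u v ∧ u < r.words m ∧ v < r.words m

theorem Rule.reach_iff {m : ℕ} {r : Rule} {u v : ℕ} (hu : u < r.words m) (hv : v < r.words m) :
    r.Reach m u v ↔ ReflTransGen (r.WordEdge m) u v := by
  constructor
  · intro h
    -- The set of words reachable from `u` is itself one of the closed sets.
    obtain ⟨C, hC, hb⟩ := exists_bit_iff (r.words m) (ReflTransGen (r.WordEdge m) u)
    refine (hb v hv).1 (h C hC ((hb u hu).2 .refl) fun x hx y hy hxC hxy => ?_)
    exact (hb y hy).2 (((hb x hx).1 hxC).tail ⟨hxy, hx, hy⟩)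
  · intro h C _ hCu hC
    induction h with
    | refl => exact hCu
    | tail _ hbc ih => exact hC _ hbc.2.1 _ hbc.2.2 (ih hbc.2.1) hbc.1

theorem mem_le_encode {α : Type*} [Encodable α] {a : α} {l : List α} (h : a ∈ l) :
    Encodable.encode a ≤ Encodable.encode l := by
  induction l with
  | nil => simp at h
  | cons b l ih =>
    have hl := Nat.left_le_pair (Encodable.encode b) (Encodable.encode l)
    have hr := Nat.right_le_pair (Encodable.encode b) (Encodable.encode l)
    rw [Encodable.encode_list_cons]
    rcases List.mem_cons.1 h with rfl | h
    · omega
    · have := ih h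
      omega

theorem Rule.encode_eq (r : Rule) :
    Encodable.encode r = Nat.pair (Encodable.encode r.premisses) r.conclusion.toNat := rfl

theorem Rule.toNat_conclusion_le (r : Rule) : r.conclusion.toNat ≤ Encodable.encode r := by
  rw [Rule.encode_eq]
  exact Nat.right_le_pair _ _

theorem Rule.toNat_le_of_mem {r : Rule} {φ : Formula} (h : φ ∈ r.premisses) :
    φ.toNat ≤ Encodable.encode r := by
  rw [Rule.encode_eq]
  exact (mem_le_encode h).trans (Nat.left_le_pair _ _)

theorem Rule.trueAtZero_iff_sat {m : ℕ} {r : Rule} {u : ℕ} {W : ℕ → Set ℕ} {x : ℕ}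
    (h : ∀ a ≤ r.span m, ∀ p < r.letters, (Bit u (a * r.letters + p) ↔ x + a ∈ W p))
    {φ : Formula} (hφ : φ.toNat ≤ Encodable.encode r) :
    TrueAtZero m r.letters (r.span m) u φ.toNat ↔ Sat m W x φ := by
  rw [trueAtZero_iff]
  refine sat_congr φ fun p hp i hi => ?_
  have hi' : i ≤ r.span m := hi.trans (Nat.mul_le_mul_left _ hφ)
  rw [← h i hi' p (by unfold Rule.letters; omega)]
  simp [wordVal, hi']

theorem Rule.edge_of_sat {m : ℕ} {r : Rule} {u v : ℕ} {W : ℕ → Set ℕ} {x : ℕ}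
    (hu : ∀ a ≤ r.span m, ∀ p < r.letters, (Bit u (a * r.letters + p) ↔ x + a ∈ W p))
    (hv : ∀ a ≤ r.span m, ∀ p < r.letters, (Bit v (a * r.letters + p) ↔ x + 1 + a ∈ W p))
    (hW : ∀ φ ∈ r.premisses, Sat m W x φ) : r.Edge m u v := by
  refine ⟨fun k hk => ?_, fun a ha p hp => ?_⟩
  · obtain ⟨φ, hφ, rfl⟩ := List.mem_map.1 hk
    exact (Rule.trueAtZero_iff_sat hu (Rule.toNat_le_of_mem hφ)).2 (hW φ hφ)
  · rw [hu (a + 1) ha p hp, hv a ha.le p hp, add_assoc, add_comm 1 a]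

theorem Rule.exists_word (m : ℕ) (r : Rule) (W : ℕ → Set ℕ) (x : ℕ) :
    ∃ u < r.words m, ∀ a ≤ r.span m, ∀ p < r.letters,
      (Bit u (a * r.letters + p) ↔ x + a ∈ W p) := by
  obtain ⟨u, hu, h⟩ := exists_bit_iff ((r.span m + 1) * r.letters) fun i =>
    x + i / r.letters ∈ W (i % r.letters)
  refine ⟨u, hu, fun a ha p hp => ?_⟩
  rw [h _ (by nlinarith), mul_comm, Nat.mul_add_mod, Nat.mul_add_div (by omega),
    Nat.mod_eq_of_lt hp, Nat.div_eq_of_lt hp, add_zero]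

theorem Rule.refutable_of_not_admissible {m : ℕ} {r : Rule}
    (h : ¬ r.Admissible (Logic m)) : r.Refutable m := by
  simp only [Rule.Admissible, not_forall] at h
  obtain ⟨σ, hprem, hconc⟩ := h
  -- The extra `1` makes the words read at the states `0` and `1` agree, which yields the loop.
  obtain ⟨V, K, X, hKX, hK, hconst⟩ :=
    exists_valuation_eventually_const σ r.letters (r.span m + 1) hconc
  set W : ℕ → Set ℕ := fun p => {x | Sat m V x (σ p)} with hWdef
  have hW (x : ℕ) : ∀ φ ∈ r.premisses, Sat m W x φ := fun φ hφ =>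
    (sat_subst σ φ x).1 (hprem φ hφ V x)
  choose word hlt hword using r.exists_word m W
  have hz : ∀ x, x ≤ 1 ∨ X ≤ x → ∀ a ≤ r.span m, ∀ p < r.letters,
      (Bit (word 0) (a * r.letters + p) ↔ x + a ∈ W p) := fun x hx a ha p hp => by
    rw [hword 0 a ha p hp]
    exact (hconst p hp (0 + a) (by omega)).trans (hconst p hp (x + a) (by omega)).symm
  have hstep (x : ℕ) : r.WordEdge m (word x) (word (x + 1)) :=
    ⟨Rule.edge_of_sat (hword x) (hword (x + 1)) (hW x), hlt _, hlt _⟩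
  have hwalk (x d : ℕ) : ReflTransGen (r.WordEdge m) (word x) (word (x + d)) := by
    induction d with
    | zero => exact .refl
    | succ d ih => exact ih.tail (hstep _)
  refine ⟨word 0, hlt 0, word K, hlt K, ?_, ?_, ?_, ?_⟩
  · exact Rule.edge_of_sat (hz 0 (by simp)) (hz 1 (by simp)) (hW 0)
  · rw [Rule.trueAtZero_iff_sat (hword K) r.toNat_conclusion_le, ← sat_subst]
    exact hK
  · rw [Rule.reach_iff (hlt _) (hlt _)]
    simpa using hwalk 0 K
  · rw [Rule.reach_iff (hlt _) (hlt _)]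
    have h1 := hwalk K (X - K)
    rw [Nat.add_sub_cancel' hKX] at h1
    -- `word 0` also describes the window at `X + 1`, so the step from `X` closes the walk.
    exact h1.tail ⟨Rule.edge_of_sat (hword X) (hz (X + 1) (by omega)) (hW X), hlt _, hlt _⟩

theorem Rule.not_admissible_of_refutable {m : ℕ} {r : Rule}
    (h : r.Refutable m) : ¬ r.Admissible (Logic m) := by
  obtain ⟨z, hz, w, hw, hzz, hwc, hzw, hwz⟩ := h
  rw [Rule.reach_iff hz hw] at hzw
  rw [Rule.reach_iff hw hz] at hwz
  obtain ⟨σ, hσ, V, s, hs, hsat, hs0⟩ := exists_subst_of_closed_walk m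
    (fun u p => Bit u p) (E := r.WordEdge m) ⟨hzz, hz, hz⟩ hzw hwz
  -- Labels record only the first state of each word; the overlaps along the walk carry state `a` of
  -- `s x` to the first state of `s (x + a)`.
  have hword {V : ℕ → Set ℕ} {s : ℕ → ℕ} (hs : ∀ x, r.WordEdge m (s x) (s (x + 1)))
      (hsat : ∀ x p, Sat m V x (σ p) ↔ Bit (s x) p) (x : ℕ) :
      ∀ a ≤ r.span m, ∀ p < r.letters,
        (Bit (s x) (a * r.letters + p) ↔ x + a ∈ {y | Sat m V y (σ p)}) := by
    intro a
    induction a generalizing x with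
    | zero =>
      intro _ p _
      simpa using (hsat x p).symm
    | succ a ih =>
      intro ha p hp
      rw [(hs x).1.2 a ha p hp, ih (x + 1) (by omega) p hp, add_assoc, add_comm 1 a]
  intro hadm
  have hconc := hadm σ fun φ hφ V x => by
    obtain ⟨s, hs, hsat⟩ := hσ V
    rw [sat_subst, ← Rule.trueAtZero_iff_sat (hword hs hsat x) (Rule.toNat_le_of_mem hφ)]
    exact (hs x).1.1 _ (List.mem_map_of_mem hφ)
  refine hwc ?_
  rw [← hs0, Rule.trueAtZero_iff_sat (hword hs hsat 0) r.toNat_conclusion_le, ← sat_subst]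
  exact hconc V 0

theorem Rule.admissible_iff {m : ℕ} {r : Rule} :
    r.Admissible (Logic m) ↔ ¬ r.Refutable m :=
  ⟨fun h h' => Rule.not_admissible_of_refutable h' h,
    fun h => by_contra fun h' => h (Rule.refutable_of_not_admissible h')⟩

/-! ### Primitive recursiveness of the graph condition -/

section Primrec

variable {α : Type} [Primcodable α]

theorem primrec_self : Primrec fun a : α => a := Primrec.id

theorem primrec_add {f g : α → ℕ} (hf : Primrec f) (hg : Primrec g) :
    Primrec fun a => f a + g a := Primrec.nat_add.comp hf hg

theorem primrec_mul {f g : α → ℕ} (hf : Primrec f) (hg : Primrec g) :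
    Primrec fun a => f a * g a := Primrec.nat_mul.comp hf hg

theorem primrec_div {f g : α → ℕ} (hf : Primrec f) (hg : Primrec g) :
    Primrec fun a => f a / g a := Primrec.nat_div.comp hf hg

theorem primrec_mod {f g : α → ℕ} (hf : Primrec f) (hg : Primrec g) :
    Primrec fun a => f a % g a := Primrec.nat_mod.comp hf hg

theorem primrec_min {f g : α → ℕ} (hf : Primrec f) (hg : Primrec g) :
    Primrec fun a => min (f a) (g a) := Primrec.nat_min.comp hf hg

theorem primrec_pow {f g : α → ℕ} (hf : Primrec f) (hg : Primrec g) :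
    Primrec fun a => f a ^ g a := (Primrec₂.unpaired'.1 Nat.Primrec.pow).comp hf hg

theorem primrec_unpair {f : α → ℕ} (hf : Primrec f) : Primrec fun a => Nat.unpair (f a) :=
  Primrec.unpair.comp hf

theorem primrec_fst {β γ : Type*} [Primcodable β] [Primcodable γ] {f : α → β × γ}
    (hf : Primrec f) : Primrec fun a => (f a).1 := Primrec.fst.comp hf

theorem primrec_snd {β γ : Type*} [Primcodable β] [Primcodable γ] {f : α → β × γ}
    (hf : Primrec f) : Primrec fun a => (f a).2 := Primrec.snd.comp hf

theorem primrecPred_eq {f g : α → ℕ} (hf : Primrec f) (hg : Primrec g) :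
    PrimrecPred fun a => f a = g a := Primrec.eq.comp hf hg

theorem primrecPred_imp {p q : α → Prop} (hp : PrimrecPred p) (hq : PrimrecPred q) :
    PrimrecPred fun a => p a → q a := (hp.not.or hq).of_eq fun _ => imp_iff_not_or.symm

theorem primrecPred_iff {p q : α → Prop} (hp : PrimrecPred p) (hq : PrimrecPred q) :
    PrimrecPred fun a => p a ↔ q a :=
  ((primrecPred_imp hp hq).and (primrecPred_imp hq hp)).of_eq fun _ => iff_def.symm

theorem primrecPred_forall_mem {β : Type} [Primcodable β] {f : α → List β} {p : α → β → Prop}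
    (hf : Primrec f) (hp : PrimrecPred fun x : α × β => p x.1 x.2) :
    PrimrecPred fun a => ∀ b ∈ f a, p a b := by
  have h : PrimrecRel fun (b : β) (a : α) => p a b := hp.comp (Primrec.snd.pair Primrec.fst)
  exact h.forall_mem_list.comp hf Primrec.id

theorem primrecPred_forall_lt {f : α → ℕ} {p : α → ℕ → Prop}
    (hf : Primrec f) (hp : PrimrecPred fun x : α × ℕ => p x.1 x.2) :
    PrimrecPred fun a => ∀ i, i < f a → p a i :=
  (primrecPred_forall_mem (Primrec.list_range.comp hf) hp).of_eq (by simp)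

theorem primrecPred_exists_lt {f : α → ℕ} {p : α → ℕ → Prop}
    (hf : Primrec f) (hp : PrimrecPred fun x : α × ℕ => p x.1 x.2) :
    PrimrecPred fun a => ∃ i, i < f a ∧ p a i :=
  (primrecPred_forall_lt (p := fun a i => ¬ p a i) hf hp.not).not.of_eq (by simp)

theorem primrecPred_bit {f g : α → ℕ} (hf : Primrec f) (hg : Primrec g) :
    PrimrecPred fun a => Bit (f a) (g a) :=
  primrecPred_eq (primrec_mod (primrec_div hf (primrec_pow (.const 2) hg)) (.const 2)) (.const 1)

theorem primrecPred_isTruthTable (m : ℕ) :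
    PrimrecPred fun x : ((((ℕ × ℕ) × ℕ) × ℕ) × ℕ) =>
      IsTruthTable m x.1.1.1.1 x.1.1.1.2 x.1.1.2 x.1.2 x.2 := by
  unfold IsTruthTable
  -- Decomposition along the syntax; reducible transparency keeps rules from matching unfolded
  -- definitions.
  repeat first
    | with_reducible exact primrec_self
    | with_reducible exact Primrec.const _
    | with_reducible apply primrecPred_forall_lt
    | with_reducible apply primrecPred_exists_lt
    | with_reducible apply primrecPred_bit
    | with_reducible apply primrecPred_eq
    | with_reducible apply primrecPred_iff
    | with_reducible apply PrimrecPred.and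
    | with_reducible apply PrimrecPred.or
    | with_reducible apply PrimrecPred.not
    | with_reducible apply primrec_add
    | with_reducible apply primrec_mul
    | with_reducible apply primrec_div
    | with_reducible apply primrec_mod
    | with_reducible apply primrec_min
    | with_reducible apply primrec_unpair
    | with_reducible apply primrec_fst
    | with_reducible apply primrec_snd

theorem primrecPred_trueAtZero (m : ℕ) {n D u k : α → ℕ} (hn : Primrec n) (hD : Primrec D)
    (hu : Primrec u) (hk : Primrec k) :
    PrimrecPred fun a => TrueAtZero m (n a) (D a) (u a) (k a) := by
  refine primrecPred_exists_lt
    (primrec_pow (.const 2) (primrec_mul (primrec_add hk (.const 1)) (primrec_add hD (.const 1))))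
    (.and ?_ ?_)
  · exact (primrecPred_isTruthTable m).comp ((((((hn.comp .fst).pair (hD.comp .fst)).pair
      (hu.comp .fst)).pair (hk.comp .fst))).pair .snd)
  · exact primrecPred_bit .snd
      (primrec_mul (hk.comp .fst) (primrec_add (hD.comp .fst) (.const 1)))

theorem primrec_toNat : Primrec Formula.toNat := Primrec.of_equiv (e := Formula.equivNat)

theorem primrec_premisses : Primrec Rule.premisses :=
  Primrec.fst.comp (Primrec.of_equiv (e := Rule.equivProd))

theorem primrec_conclusion : Primrec Rule.conclusion :=
  Primrec.snd.comp (Primrec.of_equiv (e := Rule.equivProd))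

theorem primrec_letters : Primrec Rule.letters := primrec_add .encode (.const 1)

theorem primrec_span (m : ℕ) : Primrec (Rule.span m) := primrec_mul (.const _) .encode

theorem primrec_words (m : ℕ) : Primrec (Rule.words m) :=
  primrec_pow (.const 2) (primrec_mul (primrec_add (primrec_span m) (.const 1)) primrec_letters)

theorem primrecPred_edge (m : ℕ) {r : α → Rule} {u v : α → ℕ} (hr : Primrec r) (hu : Primrec u)
    (hv : Primrec v) : PrimrecPred fun a => (r a).Edge m (u a) (v a) := by
  refine .and (primrecPred_forall_mem
    (Primrec.list_map (primrec_premisses.comp hr) (primrec_toNat.comp .snd)) ?_)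
    (primrecPred_forall_lt ((primrec_span m).comp hr)
      (primrecPred_forall_lt (primrec_letters.comp (hr.comp .fst)) ?_))
  · exact primrecPred_trueAtZero m (primrec_letters.comp (hr.comp .fst))
      ((primrec_span m).comp (hr.comp .fst)) (hu.comp .fst) .snd
  · have hl : Primrec fun x : (α × ℕ) × ℕ => (r x.1.1).letters :=
      primrec_letters.comp (hr.comp (primrec_fst .fst))
    exact primrecPred_iff
      (primrecPred_bit (hu.comp (primrec_fst .fst))
        (primrec_add (primrec_mul (primrec_add (primrec_snd .fst) (.const 1)) hl) .snd))
      (primrecPred_bit (hv.comp (primrec_fst .fst))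
        (primrec_add (primrec_mul (primrec_snd .fst) hl) .snd))

theorem primrecPred_reach (m : ℕ) {r : α → Rule} {u v : α → ℕ} (hr : Primrec r) (hu : Primrec u)
    (hv : Primrec v) : PrimrecPred fun a => (r a).Reach m (u a) (v a) := by
  refine primrecPred_forall_lt (primrec_pow (.const 2) ((primrec_words m).comp hr))
    (primrecPred_imp (primrecPred_bit .snd (hu.comp .fst)) (primrecPred_imp
      (primrecPred_forall_lt ((primrec_words m).comp (hr.comp .fst))
        (primrecPred_forall_lt ((primrec_words m).comp (hr.comp (primrec_fst .fst)))
          (primrecPred_imp ?_ (primrecPred_imp ?_ ?_))))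
      (primrecPred_bit .snd (hv.comp .fst))))
  · exact primrecPred_bit (primrec_snd (primrec_fst .fst)) (primrec_snd .fst)
  · exact primrecPred_edge m (hr.comp (primrec_fst (primrec_fst .fst))) (primrec_snd .fst) .snd
  · exact primrecPred_bit (primrec_snd (primrec_fst .fst)) .snd

theorem primrecPred_refutable (m : ℕ) : PrimrecPred (Rule.Refutable m) := by
  have hr : Primrec fun x : (Rule × ℕ) × ℕ => x.1.1 := primrec_fst .fst
  have hz : Primrec fun x : (Rule × ℕ) × ℕ => x.1.2 := primrec_snd .fst
  exact primrecPred_exists_lt (primrec_words m)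
    (primrecPred_exists_lt ((primrec_words m).comp .fst)
      ((primrecPred_edge m hr hz hz).and
        ((primrecPred_trueAtZero m (primrec_letters.comp hr) ((primrec_span m).comp hr) .snd
          (primrec_toNat.comp (primrec_conclusion.comp hr))).not.and
          ((primrecPred_reach m hr hz .snd).and (primrecPred_reach m hr .snd hz)))))

end Primrec

end LTLPast

theorem mainTheorem1 (m : ℕ) :
    ComputablePred (fun r : LTLPast.Rule => r.Admissible (LTLPast.Logic m)) :=
  ((LTLPast.primrecPred_refutable m).not.of_eq
    fun _ => LTLPast.Rule.admissible_iff.symm).computablePred
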